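/- **Theorem 5.1 (Diameter).** Let $0<\mu<1$, $0<\gamma<\beta<\alpha<1$ and $\rho>0$ be constants. For $n,l\in\mathbb N$ let $M(n,l,\mu,\Theta)$ with $\Theta=\begin{pmatrix}\alpha&\beta\\ \beta&\gamma\end{pmatrix}$ be the following random graph on $n$ nodes. Every node $u$ has an attribute vector $a(u)\in\{0,1\}^l$; all attributes of all nodes are independent, and each equals $0$ with probability $\mu$ and $1$ with probability $1-\mu$. Given the attributes, every unordered pair $\{u,v\}$ of nodes is an edge, independently of the other pairs, with probability $P[u,v]=\prod_{i=1}^{l}\Theta[a_i(u),a_i(v)]$. The weight $|u|$ of a node $u$ is the number of zeros in $a(u)$; put $S_t=\{u: |u|\ge t\}$ for real $t$, and $\lambda=\frac{\mu\beta}{\mu\beta+(1-\mu)\gamma}$. Suppose that $$\bigl(\mu\beta+(1-\mu)\gamma\bigr)^{\rho}>\tfrac12 .$$ Then there is a constant $D$, depending only on $\mu,\alpha,\beta,\gamma,\rho$, such that for every sequence $l=l(n)$ of natural numbers with $l(n)/\log_2 n\to\rho$, each of the following holds for $M(n,l(n),\mu,\Theta)$ with probability tending to $1$ as $n\to\infty$: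 1. the graph is connected and has diameter at most $D$; 2. the subgraph induced on $S_{\lambda l}$ has diameter at most $D$ (in particular any two of its nodes are joined by a path inside it); 3. every node outside $S_{\lambda l}$ is adjacent to some node of $S_{\lambda l}$. -/

import Mathlib

open MeasureTheory ProbabilityTheory Filter Topology

noncomputable section

namespace MAG

/-- Binary attribute vectors of `n` nodes: `a u i` is the value of the `i`-th attribute of `u`. -/
abbrev Attributes (n l : ℕ) : Type := Fin n → Fin l → Fin 2

/-- An indicator for every unordered pair of nodes (self-pairs included). -/
abbrev EdgeIndicators (n : ℕ) : Type := Sym2 (Fin n) → Bool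

/-- An outcome of the model: the attribute vectors and the edge indicators. -/
abbrev Outcome (n l : ℕ) : Type := Attributes n l × EdgeIndicators n

/-- The symmetric affinity matrix `Θ = [α β; β γ]`. -/
def affinity (α β γ : unitInterval) : Matrix (Fin 2) (Fin 2) unitInterval :=
  !![α, β; β, γ]

theorem affinity_symm (α β γ : unitInterval) (x y : Fin 2) :
    affinity α β γ x y = affinity α β γ y x := by
  fin_cases x <;> fin_cases y <;> rfl

/-- The edge probability `P[u, v] = ∏ i, Θ[a_i(u), a_i(v)]` of the unordered pair `s(u, v)`. -/
def edgeProb {n l : ℕ} (α β γ : unitInterval) (a : Attributes n l) :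
    Sym2 (Fin n) → unitInterval :=
  Sym2.lift ⟨fun u v => ∏ i : Fin l, affinity α β γ (a u i) (a v i), fun u v =>
    Finset.prod_congr rfl fun i _ => affinity_symm α β γ (a u i) (a v i)⟩

/-- The law of the attributes: all of them are independent, and each takes the value `0` with
probability `μ` and the value `1` with probability `1 - μ`. -/
def attributeLaw (n l : ℕ) (μ : unitInterval) : Measure (Attributes n l) :=
  Measure.pi fun _ : Fin n => Measure.pi fun _ : Fin l => bernoulliMeasure (0 : Fin 2) 1 μ

instance (n l : ℕ) (μ : unitInterval) : IsProbabilityMeasure (attributeLaw n l μ) := by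
  unfold attributeLaw; infer_instance

/-- The conditional law of the edge indicators given the attributes: they are independent, and
the indicator of `s(u, v)` is `true` with probability `P[u, v]`. -/
def edgeKernel (n l : ℕ) (α β γ : unitInterval) :
    Kernel (Attributes n l) (EdgeIndicators n) :=
  Kernel.ofFunOfCountable fun a =>
    Measure.pi fun e : Sym2 (Fin n) => bernoulliMeasure true false (edgeProb α β γ a e)

instance (n l : ℕ) (α β γ : unitInterval) : IsMarkovKernel (edgeKernel n l α β γ) :=
  ⟨fun a => by
    change IsProbabilityMeasure (Measure.pi fun e : Sym2 (Fin n) =>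
      bernoulliMeasure true false (edgeProb α β γ a e))
    infer_instance⟩

/-- The law of the multiplicative attribute graph model `M(n, l, μ, Θ)`. -/
def model (n l : ℕ) (μ α β γ : unitInterval) : Measure (Outcome n l) :=
  (attributeLaw n l μ).compProd (edgeKernel n l α β γ)

instance (n l : ℕ) (μ α β γ : unitInterval) : IsProbabilityMeasure (model n l μ α β γ) := by
  unfold model; infer_instance

/-- The random graph; self-edges, which do not influence distances, are dropped. -/
def graph {n l : ℕ} (ω : Outcome n l) : SimpleGraph (Fin n) :=
  SimpleGraph.fromEdgeSet {e | ω.2 e = true}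

/-- The weight `|u|` of a node: the number of zeros in its attribute vector. -/
def weight {n l : ℕ} (ω : Outcome n l) (u : Fin n) : ℕ :=
  (Finset.univ.filter fun i : Fin l => ω.1 u i = 0).card

/-- The set `S_t` of the nodes of weight at least `t`. -/
def core {n l : ℕ} (ω : Outcome n l) (t : ℝ) : Set (Fin n) :=
  {u | t ≤ (weight ω u : ℝ)}

/-- The ratio `λ = μ β / (μ β + (1 - μ) γ)`. -/
def coreRatio (μ β γ : unitInterval) : ℝ :=
  ((μ : ℝ) * β) / ((μ : ℝ) * β + (1 - (μ : ℝ)) * γ)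

end MAG

end

namespace MAG

/-! Let x = μβ + (1-μ)γ, and let T be the set of nodes of weight exactly k. A node has weight k with
probability q = C(l,k) μ^k (1-μ)^(l-k), and a node of T is joined to any other node with probability
at least p = β^k γ^(l-k), whatever the attributes of the other. The product p q is x^l times the
mass at k of the binomial law with success probability λ = μβ/x. Some k ≥ λl has mass of order at
least l⁻² (`exists_mean_le_binomial_mass`), and x^ρ > 1/2 makes n x^l a power of n
(`eventually_rpow_le`). So n p q ≥ n^ε for some ε > 0: every node expects a power of n many
neighbours in T, and T lies in S_{λl}.

A union bound then shows that, with high probability, small sets expand into T by a factor d of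
order n^(ε/2) (`pi_bernoulli_not_expanding_le`). Balls within T exceed half of T after a constant
number K of steps, so any two of them meet. As every node has a neighbour in T, all three claims
follow from this one event, with D = 2K + 2. -/

/-! ### Binomial weights and the size of a layer -/

/-- A binomial distribution with success probability `x` puts mass of order at least `l⁻²` on
some value that is at least its mean. -/
theorem exists_mean_le_binomial_mass {x : ℝ} (hx₀ : 0 < x) (hx₁ : x < 1) {l : ℕ} (hl : 0 < l) :
    ∃ k ≤ l, x * l ≤ k ∧
      x * (1 - x) / (2 * l * (l + 1)) ≤ (l.choose k : ℝ) * x ^ k * (1 - x) ^ (l - k) := by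
  set b : ℕ → ℝ := fun k => (l.choose k : ℝ) * x ^ k * (1 - x) ^ (l - k) with hb
  have hb0 : ∀ k, 0 ≤ b k := fun k => by
    have := sub_pos.2 hx₁
    positivity
  have e1 : ∑ k ∈ Finset.range (l + 1), b k = 1 := by
    have := congrArg (Polynomial.eval x) (bernsteinPolynomial.sum ℝ l)
    simpa [Polynomial.eval_finsetSum, bernsteinPolynomial] using this
  have e2 : ∑ k ∈ Finset.range (l + 1), (k : ℝ) * b k = l * x := by
    have := congrArg (Polynomial.eval x) (bernsteinPolynomial.sum_smul ℝ l)
    simpa [Polynomial.eval_finsetSum, bernsteinPolynomial] using this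
  have e3 : ∑ k ∈ Finset.range (l + 1), (l * x - k) ^ 2 * b k = l * x * (1 - x) := by
    have := congrArg (Polynomial.eval x) (bernsteinPolynomial.variance ℝ l)
    simpa [Polynomial.eval_finsetSum, bernsteinPolynomial] using this
  by_contra! hcon
  have hl' : (0 : ℝ) < l := by exact_mod_cast hl
  set c : ℝ := x * (1 - x) / (2 * l * (l + 1)) with hc
  have hcl : 2 * l * (l + 1) * c = x * (1 - x) := by rw [hc]; field_simp
  have hc0 : 0 < c := by
    have := sub_pos.2 hx₁
    positivity
  -- The test function (k - lx)² + l(k - lx) = (k - lx)(k - lx + l) is nonpositive below the mean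
  -- and at most 2l² above it, while its expectation is the variance l x (1 - x). Masses all below c
  -- above the mean would make that expectation too small.
  have key : ∑ k ∈ Finset.range (l + 1), ((l * x - k) ^ 2 * b k + l * ((k - l * x) * b k)) <
      ∑ _k ∈ Finset.range (l + 1), l * (2 * l * c) := by
    refine Finset.sum_lt_sum_of_nonempty ⟨0, by simp⟩ fun k hk => ?_
    have hkl : k ≤ l := Nat.lt_succ_iff.1 (Finset.mem_range.1 hk)
    have hkl' : (k : ℝ) ≤ l := by exact_mod_cast hkl
    have hk0 : (0 : ℝ) ≤ k := k.cast_nonneg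
    have hxl : 0 < l * x := by positivity
    rcases le_or_gt (x * l) k with h | h
    · have h1 := hcon k hkl h
      have h2 : (l * x - k) ^ 2 + l * (k - l * x) ≤ l * (2 * l) := by nlinarith
      calc _ = ((l * x - k) ^ 2 + l * (k - l * x)) * b k := by ring
        _ ≤ l * (2 * l) * b k := mul_le_mul_of_nonneg_right h2 (hb0 k)
        _ < l * (2 * l) * c := mul_lt_mul_of_pos_left h1 (by positivity)
        _ = _ := by ring
    · have h2 : (l * x - k) ^ 2 + l * (k - l * x) ≤ 0 := by nlinarith
      calc _ = ((l * x - k) ^ 2 + l * (k - l * x)) * b k := by ring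
        _ ≤ 0 := mul_nonpos_of_nonpos_of_nonneg h2 (hb0 k)
        _ < _ := by positivity
  have e4 : ∑ k ∈ Finset.range (l + 1), (k - l * x) * b k = 0 := by
    simp only [sub_mul, Finset.sum_sub_distrib, ← Finset.mul_sum, e1, e2]
    ring
  rw [Finset.sum_add_distrib, e3, ← Finset.mul_sum, e4] at key
  simp only [Finset.sum_const, Finset.card_range, nsmul_eq_mul] at key
  push_cast at key
  nlinarith

/-- Among independent samples of `ν`, the number of those in `s` is rarely below a quarter of its
expectation. -/
theorem pi_card_filter_lt_le {Ω : Type*} [MeasurableSpace Ω] [Finite Ω]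
    [MeasurableSingletonClass Ω] (ν : Measure Ω) [IsProbabilityMeasure ν] (n : ℕ) (s : Set Ω)
    [DecidablePred (· ∈ s)] :
    (Measure.pi fun _ : Fin n => ν).real
      {a | ((Finset.univ.filter fun u => a u ∈ s).card : ℝ) < n * ν.real s / 4} ≤
      Real.exp (-(n * ν.real s / 4)) := by
  set q := ν.real s
  have hs : MeasurableSet s := s.toFinite.measurableSet
  -- Chernoff bound: `f` is exp(-count), whose mean is at most exp(-nq/2); Markov's inequality is
  -- applied at the level exp(-nq/4).
  set g : Ω → ℝ := fun x => if x ∈ s then Real.exp (-1) else 1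
  set f : (Fin n → Ω) → ℝ := fun a => ∏ u, g (a u)
  have hg : ∫ x, g x ∂ν ≤ Real.exp (-(q / 2)) := by
    have h1 : g = fun x => 1 - s.indicator (fun _ => 1 - Real.exp (-1)) x := by
      funext x
      by_cases h : x ∈ s <;> simp [g, h]
    rw [h1, integral_sub (integrable_const _) ((integrable_const _).indicator hs),
      integral_indicator_const _ hs]
    have h2 : Real.exp (-1) ≤ 1 / 2 := by
      have := Real.exp_neg_one_lt_d9
      linarith
    have h3 : 0 ≤ q := measureReal_nonneg
    have h4 := Real.one_sub_le_exp_neg (q / 2)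
    simp only [integral_const, probReal_univ, smul_eq_mul]
    change 1 * 1 - q * (1 - Real.exp (-1)) ≤ _
    nlinarith
  have hg0 : ∀ x, 0 ≤ g x := fun x => by
    simp only [g]
    split_ifs <;> positivity
  have hf : ∫ a, f a ∂(Measure.pi fun _ : Fin n => ν) ≤ Real.exp (-(n * q / 2)) := by
    simp only [f]
    rw [integral_fintype_prod_eq_prod (μ := fun _ : Fin n => ν) (fun _ : Fin n => g)]
    rw [Finset.prod_const, Finset.card_univ, Fintype.card_fin]
    calc _ ≤ Real.exp (-(q / 2)) ^ n := pow_le_pow_left₀ (integral_nonneg hg0) hg n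
      _ = _ := by rw [← Real.exp_nat_mul]; ring_nf
  have hfa : ∀ a, f a = Real.exp (-((Finset.univ.filter fun u => a u ∈ s).card : ℝ)) := fun a => by
    simp only [f, g]
    rw [Finset.prod_ite, Finset.prod_const, Finset.prod_const_one, mul_one, ← Real.exp_nat_mul]
    ring_nf
  have hm := mul_meas_ge_le_integral_of_nonneg (μ := Measure.pi fun _ : Fin n => ν) (f := f)
    (Eventually.of_forall fun a => Finset.prod_nonneg fun u _ => hg0 _)
    Integrable.of_finite (Real.exp (-(n * q / 4)))
  have hsub : (Measure.pi fun _ : Fin n => ν).real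
      {a | ((Finset.univ.filter fun u => a u ∈ s).card : ℝ) < n * q / 4} ≤
      (Measure.pi fun _ : Fin n => ν).real {a | Real.exp (-(n * q / 4)) ≤ f a} := by
    refine measureReal_mono fun a ha => ?_
    simp only [Set.mem_ofPred_eq] at ha ⊢
    rw [hfa]
    exact Real.exp_le_exp.2 (by linarith)
  refine hsub.trans ?_
  have h5 : Real.exp (-(n * q / 2)) = Real.exp (-(n * q / 4)) * Real.exp (-(n * q / 4)) := by
    rw [← Real.exp_add]; ring_nf
  have := hm.trans hf
  rw [h5] at this
  exact le_of_mul_le_mul_left this (Real.exp_pos _)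

/-- The number of zeros among independent Bernoulli attributes is binomially distributed. -/
theorem pi_bernoulli_card_zeros (l k : ℕ) (μ : unitInterval) :
    (Measure.pi fun _ : Fin l => bernoulliMeasure (0 : Fin 2) 1 μ).real
      {a | (Finset.univ.filter fun i => a i = 0).card = k} =
      (l.choose k : ℝ) * (μ : ℝ) ^ k * (1 - (μ : ℝ)) ^ (l - k) := by
  have hset : {a : Fin l → Fin 2 | (Finset.univ.filter fun i => a i = 0).card = k} =
      ⋃ F ∈ Finset.powersetCard k (Finset.univ : Finset (Fin l)),
        {a : Fin l → Fin 2 | (Finset.univ.filter fun i => a i = 0) = F} := by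
    ext a
    simp [Finset.mem_powersetCard]
  rw [hset, measureReal_biUnion_finset]
  · have : ∀ F ∈ Finset.powersetCard k (Finset.univ : Finset (Fin l)),
        (Measure.pi fun _ : Fin l => bernoulliMeasure (0 : Fin 2) 1 μ).real
          {a : Fin l → Fin 2 | (Finset.univ.filter fun i => a i = 0) = F} =
        (μ : ℝ) ^ k * (1 - (μ : ℝ)) ^ (l - k) := fun F hF => by
      have h1 : {a : Fin l → Fin 2 | (Finset.univ.filter fun i => a i = 0) = F} =
          Set.pi Set.univ fun i => ({if i ∈ F then 0 else 1} : Set (Fin 2)) := by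
        ext a
        simp only [Set.mem_ofPred_eq, Set.mem_pi, Set.mem_univ, Set.mem_singleton_iff, forall_true_left,
          Finset.ext_iff, Finset.mem_filter, Finset.mem_univ, true_and]
        refine forall_congr' fun i => ?_
        generalize a i = y
        by_cases hi : i ∈ F <;> fin_cases y <;> simp [hi]
      rw [h1, measureReal_def, Measure.pi_pi, ENNReal.toReal_prod]
      have h2 : ∀ i : Fin l, (bernoulliMeasure (0 : Fin 2) 1 μ
          {if i ∈ F then 0 else 1}).toReal = if i ∈ F then (μ : ℝ) else 1 - μ := fun i => by
        rw [← measureReal_def]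
        split_ifs <;> simp
      have hF' := (Finset.mem_powersetCard.1 hF).2
      simp only [h2]
      rw [Finset.prod_ite]
      simp [Finset.filter_not, Finset.card_sdiff, hF']
    rw [Finset.sum_congr rfl this, Finset.sum_const, Finset.card_powersetCard]
    simp [mul_assoc]
  · intro F _ F' _ hne
    refine Set.disjoint_left.2 fun a ha ha' => hne ?_
    exact ha.symm.trans ha'
  · exact fun F _ => (Set.toFinite _).measurableSet

end MAG

/-! ### Expansion into a set bounds the diameter -/

namespace MAG

/-- Every small set of nodes has many neighbours in `T`: a set `W ⊇ A` that has at most `d`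
times the size of `A ≠ ∅`, and at most two thirds of the size of `T`, does not contain all
neighbours of `A` in `T`. -/
def Expanding {V : Type*} (G : SimpleGraph V) (T : Finset V) (d : ℕ) : Prop :=
  ∀ A W : Finset V, A.Nonempty → A ⊆ W → W.card ≤ d * A.card → 3 * W.card ≤ 2 * T.card →
    ∃ a ∈ A, ∃ t ∈ T, t ∉ W ∧ G.Adj a t

namespace Expanding

variable {V : Type*} {G : SimpleGraph V} {T : Finset V} {d : ℕ}

theorem exists_adj (h : Expanding G T d) (hd : 1 ≤ d) (hT : 2 ≤ T.card) (u : V) :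
    ∃ t ∈ T, G.Adj u t := by
  obtain ⟨a, ha, t, ht, -, hat⟩ := h {u} {u} (by simp) subset_rfl (by simpa using hd)
    (by simp; omega)
  rw [Finset.mem_singleton] at ha
  exact ⟨t, ht, ha ▸ hat⟩

-- If the ball of radius k + 1 met neither alternative, it would be an admissible `W` for the ball
-- `A` of radius k. Expansion would then give a neighbour of `A` in `T` outside `W`, yet that
-- neighbour is within distance k + 1.
open Classical in
theorem card_ball (h : Expanding G T d) {Z : Set V} (hTZ : (T : Set V) ⊆ Z) (u : Z)
    (hu : (u : V) ∈ T) (k : ℕ) :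
    d ^ k ≤ (T.filter fun t => ∃ ht : t ∈ Z, (G.induce Z).edist u ⟨t, ht⟩ ≤ k).card ∨
      2 * T.card < 3 * (T.filter fun t => ∃ ht : t ∈ Z, (G.induce Z).edist u ⟨t, ht⟩ ≤ k).card := by
  have hmem : ∀ k : ℕ, (u : V) ∈
      T.filter fun t => ∃ ht : t ∈ Z, (G.induce Z).edist u ⟨t, ht⟩ ≤ k := fun k =>
    Finset.mem_filter.2 ⟨hu, u.2, by simp⟩
  induction k with
  | zero =>
    left
    simpa using Finset.card_pos.2 ⟨_, hmem 0⟩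
  | succ k ih =>
    set A := T.filter fun t => ∃ ht : t ∈ Z, (G.induce Z).edist u ⟨t, ht⟩ ≤ k with hA
    set W := T.filter fun t => ∃ ht : t ∈ Z, (G.induce Z).edist u ⟨t, ht⟩ ≤ (k + 1 : ℕ) with hW
    have hAW : A ⊆ W := fun t ht => by
      obtain ⟨h1, h2, h3⟩ := Finset.mem_filter.1 ht
      exact Finset.mem_filter.2 ⟨h1, h2, h3.trans (by exact_mod_cast k.le_succ)⟩
    have hc := Finset.card_le_card hAW
    by_contra! hcon
    have hIH : d ^ k ≤ A.card := ih.resolve_right (by omega)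
    have hWA : W.card ≤ d * A.card := by
      have := Nat.mul_le_mul_left d hIH
      rw [pow_succ'] at hcon
      omega
    obtain ⟨a, ha, t, ht, htW, hat⟩ := h A W ⟨_, hmem k⟩ hAW hWA hcon.2
    obtain ⟨-, haZ, hua⟩ := Finset.mem_filter.1 ha
    refine htW (Finset.mem_filter.2 ⟨ht, hTZ ht, ?_⟩)
    have hadj : (G.induce Z).Adj ⟨a, haZ⟩ ⟨t, hTZ ht⟩ := hat
    calc _ ≤ (G.induce Z).edist u ⟨a, haZ⟩ + (G.induce Z).edist ⟨a, haZ⟩ ⟨t, hTZ ht⟩ :=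
          SimpleGraph.edist_triangle
      _ ≤ k + 1 := add_le_add hua (SimpleGraph.edist_eq_one_iff_adj.2 hadj).le
      _ = ((k + 1 : ℕ) : ℕ∞) := by push_cast; rfl

/-- When d^K ≥ |T|, either alternative of `card_ball` makes the two balls of radius K larger than
half of `T`, so they intersect. -/
theorem edist_le (h : Expanding G T d) {Z : Set V} (hTZ : (T : Set V) ⊆ Z) {K : ℕ}
    (hK : T.card ≤ d ^ K) (u v : Z) (hu : (u : V) ∈ T) (hv : (v : V) ∈ T) :
    (G.induce Z).edist u v ≤ (2 * K : ℕ) := by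
  classical
  have hpos : 0 < T.card := Finset.card_pos.2 ⟨_, hu⟩
  have hcu := h.card_ball hTZ u hu K
  have hcv := h.card_ball hTZ v hv K
  set A := T.filter fun t => ∃ ht : t ∈ Z, (G.induce Z).edist u ⟨t, ht⟩ ≤ K
  set B := T.filter fun t => ∃ ht : t ∈ Z, (G.induce Z).edist v ⟨t, ht⟩ ≤ K
  have hne : ¬ Disjoint A B := fun hdis => by
    have h1 := Finset.card_union_of_disjoint hdis
    have h2 := Finset.card_le_card
      (Finset.union_subset (Finset.filter_subset _ T) (Finset.filter_subset _ T) : A ∪ B ⊆ T)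
    omega
  obtain ⟨w, hwA, hwB⟩ := Finset.not_disjoint_iff.1 hne
  obtain ⟨-, hwZ, huw⟩ := Finset.mem_filter.1 hwA
  obtain ⟨-, _, hvw⟩ := Finset.mem_filter.1 hwB
  rw [SimpleGraph.edist_comm] at hvw
  calc _ ≤ (G.induce Z).edist u ⟨w, hwZ⟩ + (G.induce Z).edist ⟨w, hwZ⟩ v :=
        SimpleGraph.edist_triangle
    _ ≤ K + K := add_le_add huw hvw
    _ = ((2 * K : ℕ) : ℕ∞) := by rw [two_mul]; push_cast; rfl

/-- A set of nodes that contains `T` induces a subgraph of small diameter. -/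
theorem ediam_induce_le (h : Expanding G T d) (hd : 1 ≤ d) (hT : 2 ≤ T.card) {Z : Set V}
    (hTZ : (T : Set V) ⊆ Z) {K : ℕ} (hK : T.card ≤ d ^ K) :
    (G.induce Z).ediam ≤ (2 * K + 2 : ℕ) := by
  rw [SimpleGraph.ediam_le_iff]
  intro u v
  obtain ⟨s, hs, hus⟩ := h.exists_adj hd hT u
  obtain ⟨t, ht, hvt⟩ := h.exists_adj hd hT v
  have h1 : (G.induce Z).Adj u ⟨s, hTZ hs⟩ := hus
  have h2 : (G.induce Z).Adj ⟨t, hTZ ht⟩ v := hvt.symm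
  calc _ ≤ (G.induce Z).edist u ⟨s, hTZ hs⟩ + (G.induce Z).edist ⟨s, hTZ hs⟩ v :=
        SimpleGraph.edist_triangle
    _ ≤ (G.induce Z).edist u ⟨s, hTZ hs⟩ + ((G.induce Z).edist ⟨s, hTZ hs⟩ ⟨t, hTZ ht⟩ +
        (G.induce Z).edist ⟨t, hTZ ht⟩ v) := by gcongr; exact SimpleGraph.edist_triangle
    _ ≤ 1 + ((2 * K : ℕ) + 1) := by
        gcongr
        · exact (SimpleGraph.edist_eq_one_iff_adj.2 h1).le
        · exact h.edist_le hTZ hK _ _ hs ht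
        · exact (SimpleGraph.edist_eq_one_iff_adj.2 h2).le
    _ = ((2 * K + 2 : ℕ) : ℕ∞) := by push_cast; ring

theorem ediam_le (h : Expanding G T d) (hd : 1 ≤ d) (hT : 2 ≤ T.card) {K : ℕ}
    (hK : T.card ≤ d ^ K) : G.ediam ≤ (2 * K + 2 : ℕ) := by
  rw [SimpleGraph.ediam_le_iff]
  intro u v
  have h1 := SimpleGraph.ediam_le_iff.1
    (h.ediam_induce_le hd hT (Set.subset_univ _) hK) ⟨u, trivial⟩ ⟨v, trivial⟩
  obtain ⟨w, hw⟩ := SimpleGraph.exists_walk_of_edist_ne_top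
    (ne_top_of_le_ne_top (ENat.natCast_ne_top _) h1)
  rw [← hw] at h1
  refine le_trans ?_ h1
  exact (w.map (SimpleGraph.Embedding.induce Set.univ).toHom).edist_le.trans
    (by rw [SimpleGraph.Walk.length_map])

end Expanding

/-! ### Independent edges expand with high probability -/

section RandomEdges

variable {V : Type*} [Fintype V]

theorem pi_bernoulli_forall_false_le {E : Type*} [Fintype E] (P : E → unitInterval) (F : Finset E)
    {p : ℝ} (hp : ∀ e ∈ F, p ≤ P e) :
    (Measure.pi fun e => bernoulliMeasure true false (P e)).real {x | ∀ e ∈ F, x e = false} ≤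
      Real.exp (-p) ^ F.card := by
  classical
  have h1 : {x : E → Bool | ∀ e ∈ F, x e = false} =
      Set.pi Set.univ fun e => if e ∈ F then {false} else Set.univ := by
    ext x
    simp only [Set.mem_ofPred_eq, Set.mem_pi, Set.mem_univ, forall_true_left]
    refine forall_congr' fun e => ?_
    by_cases he : e ∈ F <;> simp [he]
  have h2 : ∀ e, (bernoulliMeasure true false (P e) (if e ∈ F then {false} else Set.univ)).toReal =
      if e ∈ F then 1 - (P e : ℝ) else 1 := fun e => by
    rw [← measureReal_def]
    split_ifs <;> simp
  rw [h1, measureReal_def, Measure.pi_pi, ENNReal.toReal_prod, Finset.prod_congr rfl fun e _ => h2 e,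
    Finset.prod_ite, Finset.prod_const_one, mul_one, ← Finset.prod_const]
  rw [Finset.filter_mem_eq_inter, Finset.univ_inter]
  refine Finset.prod_le_prod (fun e _ => sub_nonneg.2 (P e).2.2) fun e he => ?_
  exact (sub_le_sub_left (hp e he) 1).trans (Real.one_sub_le_exp_neg p)

/-- All pairs between `A` and `T \ W` must be non-edges. They are distinct as unordered pairs
because `A ⊆ W`, and `T \ W` keeps at least a third of `T`. -/
theorem pi_bernoulli_forall_not_adj_le [DecidableEq V] (P : Sym2 V → unitInterval)
    (A W T : Finset V) (hAW : A ⊆ W) (hWT : 3 * W.card ≤ 2 * T.card) {p : ℝ} (hp₀ : 0 ≤ p)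
    (hp : ∀ u, ∀ t ∈ T, p ≤ P s(u, t)) :
    (Measure.pi fun e => bernoulliMeasure true false (P e)).real
      {x | ¬ ∃ a ∈ A, ∃ t ∈ T, t ∉ W ∧ (SimpleGraph.fromEdgeSet {e | x e = true}).Adj a t} ≤
      Real.exp (-(p * T.card / 3)) ^ A.card := by
  set F : Finset (Sym2 V) := (A ×ˢ (T \ W)).image fun z => s(z.1, z.2) with hF
  have hcard : F.card = A.card * (T \ W).card := by
    rw [hF, Finset.card_image_of_injOn, Finset.card_product]
    rintro ⟨a, t⟩ h1 ⟨a', t'⟩ h2 h3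
    simp only [Finset.coe_product, Set.mem_prod, Finset.mem_coe, Finset.mem_sdiff] at h1 h2
    simp only [Sym2.eq_iff] at h3
    rcases h3 with ⟨rfl, rfl⟩ | ⟨rfl, rfl⟩
    · rfl
    · exact absurd (hAW h1.1) h2.2.2
  have hsub : {x : Sym2 V → Bool | ¬ ∃ a ∈ A, ∃ t ∈ T, t ∉ W ∧
      (SimpleGraph.fromEdgeSet {e | x e = true}).Adj a t} ⊆ {x | ∀ e ∈ F, x e = false} := by
    intro x hx e he
    obtain ⟨⟨a, t⟩, hz, rfl⟩ := Finset.mem_image.1 he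
    obtain ⟨ha, ht⟩ := Finset.mem_product.1 hz
    obtain ⟨htT, htW⟩ := Finset.mem_sdiff.1 ht
    by_contra hne
    refine hx ⟨a, ha, t, htT, htW, ?_⟩
    rw [SimpleGraph.fromEdgeSet_adj]
    refine ⟨by simpa using hne, ?_⟩
    rintro rfl
    exact htW (hAW ha)
  refine (measureReal_mono hsub).trans ((pi_bernoulli_forall_false_le P F (p := p) ?_).trans ?_)
  · intro e he
    obtain ⟨⟨a, t⟩, hz, rfl⟩ := Finset.mem_image.1 he
    exact hp a t (Finset.mem_sdiff.1 (Finset.mem_product.1 hz).2).1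
  · rw [hcard, mul_comm A.card, pow_mul, ← Real.exp_nat_mul]
    refine pow_le_pow_left₀ (Real.exp_pos _).le (Real.exp_le_exp.2 ?_) _
    have h1 := Finset.le_card_sdiff W T
    have h2 : T.card ≤ 3 * (T \ W).card := by omega
    have h3 : (T.card : ℝ) ≤ 3 * (T \ W).card := by exact_mod_cast h2
    nlinarith

/-- If the edge probabilities towards `T` are at least `p` and `p * #T` is large, then the random
graph is likely to be expanding. -/
theorem pi_bernoulli_not_expanding_le [DecidableEq V] [Nonempty V] (P : Sym2 V → unitInterval)
    (T : Finset V) (d : ℕ) {p : ℝ} (hp₀ : 0 ≤ p) (hp : ∀ u, ∀ t ∈ T, p ≤ P s(u, t))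
    (hd : Real.exp (-(p * T.card / 3)) * (Fintype.card V : ℝ) ^ d ≤
      1 / (Fintype.card V : ℝ) ^ 2) :
    (Measure.pi fun e => bernoulliMeasure true false (P e)).real
      {x | ¬ Expanding (SimpleGraph.fromEdgeSet {e | x e = true}) T d} ≤
      (Real.exp (1 / Fintype.card V) - 1) * Real.exp 1 := by
  set N : ℝ := (Fintype.card V : ℝ) with hN
  have hN1 : 1 ≤ N := by
    rw [hN]
    exact_mod_cast Fintype.card_pos
  have hN0 : 0 < N := by linarith
  set θ := Real.exp (-(p * T.card / 3)) with hθ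
  have hθ0 : 0 < θ := Real.exp_pos _
  set r := θ * N ^ d with hr
  have hr0 : 0 ≤ r := by positivity
  set I : Finset (Finset V × Finset V) := Finset.univ.filter fun z =>
    z.1.Nonempty ∧ z.1 ⊆ z.2 ∧ z.2.card ≤ d * z.1.card ∧ 3 * z.2.card ≤ 2 * T.card with hI
  have hsub : {x : Sym2 V → Bool |
      ¬ Expanding (SimpleGraph.fromEdgeSet {e | x e = true}) T d} ⊆
      ⋃ z ∈ I, {x | ¬ ∃ a ∈ z.1, ∃ t ∈ T, t ∉ z.2 ∧
        (SimpleGraph.fromEdgeSet {e | x e = true}).Adj a t} := by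
    intro x hx
    simp only [Expanding, Set.mem_ofPred_eq, not_forall] at hx
    obtain ⟨A, W, h1, h2, h3, h4, h5⟩ := hx
    exact Set.mem_iUnion₂.2 ⟨(A, W), by simp [hI, h1, h2, h3, h4], h5⟩
  refine (measureReal_mono hsub (measure_ne_top _ _)).trans
    ((measureReal_biUnion_finset_le _ _).trans ?_)
  -- Since |W| ≤ d|A|, the factor N^(d|A|) N^(-|W|) is at least 1. Inserting it decouples `A` from
  -- `W`, and the double sum factors into two binomial expansions.
  have hterm : ∀ z ∈ I, (Measure.pi fun e => bernoulliMeasure true false (P e)).real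
      {x | ¬ ∃ a ∈ z.1, ∃ t ∈ T, t ∉ z.2 ∧
        (SimpleGraph.fromEdgeSet {e | x e = true}).Adj a t} ≤
      r ^ z.1.card * (1 / N) ^ z.2.card := by
    intro z hz
    obtain ⟨-, -, h2, h3, h4⟩ := Finset.mem_filter.1 hz
    refine (pi_bernoulli_forall_not_adj_le P z.1 z.2 T h2 h4 hp₀ hp).trans ?_
    rw [hr, mul_pow, ← pow_mul, mul_assoc]
    refine le_mul_of_one_le_right (by positivity) ?_
    rw [one_div, inv_pow, ← div_eq_mul_inv, one_le_div (by positivity)]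
    exact pow_le_pow_right₀ hN1 h3
  refine (Finset.sum_le_sum hterm).trans ?_
  have hIsub : I ⊆ (Finset.univ.erase ∅) ×ˢ Finset.univ := fun z hz => by
    obtain ⟨-, h1, -⟩ := Finset.mem_filter.1 hz
    simp [h1.ne_empty]
  refine (Finset.sum_le_sum_of_subset_of_nonneg hIsub fun z _ _ => by positivity).trans ?_
  simp only [Finset.sum_product]
  rw [← Finset.sum_mul_sum]
  have hs : ∀ y : ℝ, ∑ A : Finset V, y ^ A.card = (1 + y) ^ Fintype.card V := fun y => by
    have := Fintype.sum_pow_mul_eq_add_pow V y 1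
    simp only [one_pow, mul_one] at this
    rw [this, add_comm]
  have hle : ∀ y : ℝ, 0 ≤ y → (1 + y) ^ Fintype.card V ≤ Real.exp (N * y) := fun y hy => by
    rw [hN, Real.exp_nat_mul]
    refine pow_le_pow_left₀ (by positivity) ?_ _
    linarith [Real.add_one_le_exp y]
  have h1 : ∑ A ∈ Finset.univ.erase (∅ : Finset V), r ^ A.card ≤ Real.exp (1 / N) - 1 := by
    have := Finset.sum_erase_add Finset.univ (fun A : Finset V => r ^ A.card) (Finset.mem_univ ∅)
    rw [hs, Finset.card_empty, pow_zero] at this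
    have h2 : N * r ≤ 1 / N := by
      calc N * r ≤ N * (1 / N ^ 2) := by gcongr
        _ = 1 / N := by field_simp
    linarith [(hle r hr0).trans (Real.exp_le_exp.2 h2)]
  have h2 : ∑ W : Finset V, (1 / N) ^ W.card ≤ Real.exp 1 := by
    rw [hs]
    refine (hle _ (by positivity)).trans (Real.exp_le_exp.2 ?_)
    exact (mul_one_div_cancel hN0.ne').le
  exact mul_le_mul h1 h2 (Finset.sum_nonneg fun W _ => by positivity)
    (sub_nonneg.2 (Real.one_le_exp (by positivity)))

end RandomEdges

end MAG

/-! ### Asymptotics of the parameters -/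

namespace MAG

/-- If `x ^ ρ > 1 / 2` and `l n ∼ ρ log₂ n`, then `n * x ^ l n` exceeds a power of `n`, even after
division by a quadratic polynomial in `l n`. -/
theorem eventually_rpow_le {x ρ c : ℝ} (hx : 0 < x) (hρ : 0 < ρ)
    (hxρ : 1 / 2 < x ^ ρ) (hc : 0 < c) :
    ∃ ε : ℝ, 0 < ε ∧ ∀ l : ℕ → ℕ, Tendsto (fun n : ℕ => (l n : ℝ) / Real.logb 2 (n : ℝ)) atTop (𝓝 ρ) →
      ∀ᶠ n in atTop, 0 < l n ∧ (n : ℝ) ^ ε ≤ n * x ^ l n * (c / (2 * l n * (l n + 1))) := by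
  have hlog2 : 0 < Real.log 2 := Real.log_pos one_lt_two
  have h1 : -Real.log 2 < ρ * Real.log x := by
    have := Real.log_lt_log (by norm_num) hxρ
    rwa [Real.log_rpow hx, one_div, Real.log_inv] at this
  -- This choice gives n x^l ≥ n^(2ε) eventually: one factor n^ε is kept, the other absorbs
  -- 2l(l+1)/c. It does not depend on the sequence l, so neither will D.
  obtain ⟨ε, hε, hερ⟩ : ∃ ε > 0, -Real.log 2 * (1 - 2 * ε) < ρ * Real.log x := by
    refine ⟨(ρ * Real.log x + Real.log 2) / (4 * Real.log 2), by
      have : 0 < ρ * Real.log x + Real.log 2 := by linarith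
      positivity, ?_⟩
    have : Real.log 2 * (2 * ((ρ * Real.log x + Real.log 2) / (4 * Real.log 2))) =
        (ρ * Real.log x + Real.log 2) / 2 := by
      field_simp
      ring
    linarith
  refine ⟨ε, hε, fun l hl => ?_⟩
  have ht1 := (hl.mul_const (Real.log x)).eventually_const_lt hερ
  have ht2 := hl.eventually_lt_const (lt_add_one ρ)
  have ht3 := hl.eventually_const_lt hρ
  set δ : ℝ := Real.log 2 / (2 * (ρ + 1)) * Real.sqrt c with hδ
  have hδ0 : 0 < δ := by positivity
  have ht4 := ((isLittleO_log_rpow_atTop (half_pos hε)).comp_tendsto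
    tendsto_natCast_atTop_atTop).bound hδ0
  filter_upwards [ht1, ht2, ht3, ht4, eventually_ge_atTop 2] with n h1 h2 h3 h4 hn
  have hn0 : (0 : ℝ) < n := by exact_mod_cast (by omega : 0 < n)
  have hn1 : (1 : ℝ) < n := by exact_mod_cast (by omega : 1 < n)
  have hlogn : 0 < Real.log n := Real.log_pos hn1
  have hL : Real.logb 2 n = Real.log n / Real.log 2 := rfl
  have hL0 : 0 < Real.logb 2 n := by rw [hL]; positivity
  have hl0 : 0 < l n := by
    by_contra h
    have : l n = 0 := by omega
    simp [this] at h3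
  refine ⟨hl0, ?_⟩
  have hl1 : (1 : ℝ) ≤ l n := by exact_mod_cast hl0
  have hlL : (l n : ℝ) ≤ (ρ + 1) * Real.logb 2 n := ((div_lt_iff₀ hL0).1 h2).le
  have hb1 : -(1 - 2 * ε) * Real.log n ≤ l n * Real.log x := by
    have h5 := mul_lt_mul_of_pos_right h1 hL0
    rw [div_mul_eq_mul_div, div_mul_cancel₀ _ hL0.ne', hL] at h5
    have h6 : -Real.log 2 * (1 - 2 * ε) * (Real.log n / Real.log 2) =
      -(1 - 2 * ε) * Real.log n := by field_simp
    linarith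
  have hb2 : (n : ℝ) ^ ε * (n : ℝ) ^ ε ≤ n * x ^ l n := by
    rw [← Real.rpow_add hn0, ← Real.rpow_natCast x, Real.rpow_def_of_pos hn0,
      Real.rpow_def_of_pos hx]
    nth_rw 2 [← Real.exp_log hn0]
    rw [← Real.exp_add]
    exact Real.exp_le_exp.2 (by linarith)
  have hb3 : 2 * l n * ((l n : ℝ) + 1) ≤ c * (n : ℝ) ^ ε := by
    simp only [Function.comp_apply, Real.norm_eq_abs, abs_of_pos hlogn,
      abs_of_pos (Real.rpow_pos_of_pos hn0 _)] at h4
    have h5 : 2 * (l n : ℝ) ≤ Real.sqrt c * (n : ℝ) ^ (ε / 2) := by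
      calc 2 * (l n : ℝ) ≤ 2 * ((ρ + 1) * (Real.log n / Real.log 2)) := by rw [← hL]; linarith
        _ ≤ 2 * ((ρ + 1) * (δ * (n : ℝ) ^ (ε / 2) / Real.log 2)) := by gcongr
        _ = _ := by rw [hδ]; field_simp
    have h6 : ((n : ℝ) ^ (ε / 2)) ^ 2 = (n : ℝ) ^ ε := by
      rw [← Real.rpow_natCast, ← Real.rpow_mul hn0.le]
      congr 1
      push_cast
      ring
    have h7 := pow_le_pow_left₀ (by positivity) h5 2
    rw [mul_pow (Real.sqrt c), Real.sq_sqrt hc.le, h6] at h7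
    nlinarith
  rw [← mul_div_assoc, le_div_iff₀ (by positivity)]
  have : 0 < (n : ℝ) ^ ε := by positivity
  nlinarith [mul_le_mul_of_nonneg_left hb3 this.le, mul_le_mul_of_nonneg_right hb2 hc.le]

/-- Growth factors `d n` that are small enough for expansion with high probability, and such that
a fixed power of `d n` exceeds `n`. -/
theorem exists_growth {ε : ℝ} (hε : 0 < ε) :
    ∃ (K : ℕ) (d : ℕ → ℕ), ∀ᶠ n : ℕ in atTop, 1 ≤ d n ∧ n ≤ d n ^ K ∧ (8 : ℝ) ≤ (n : ℝ) ^ ε ∧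
      Real.exp (-((n : ℝ) ^ ε / 12)) * (n : ℝ) ^ d n ≤ 1 / (n : ℝ) ^ 2 := by
  -- Rounding down leaves d ≥ n^(ε/4), hence d^K ≥ n. The last estimate amounts to (d + 2) log n ≤
  -- n^ε / 12.
  refine ⟨⌈4 / ε⌉₊, fun n => ⌊(n : ℝ) ^ (ε / 2)⌋₊, ?_⟩
  have t1 := ((isLittleO_log_rpow_atTop (half_pos hε)).comp_tendsto
    tendsto_natCast_atTop_atTop).bound (by norm_num : (0 : ℝ) < 1 / 36)
  have t2 := ((tendsto_rpow_atTop hε).comp tendsto_natCast_atTop_atTop).eventually_ge_atTop (8 : ℝ)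
  have t3 := ((tendsto_rpow_atTop (by positivity : 0 < ε / 4)).comp
    tendsto_natCast_atTop_atTop).eventually_ge_atTop (2 : ℝ)
  filter_upwards [t1, t2, t3, eventually_ge_atTop 2] with n h1 h2 h3 hn
  have hn0 : (0 : ℝ) < n := by exact_mod_cast (by omega : 0 < n)
  have hn1 : (1 : ℝ) < n := by exact_mod_cast (by omega : 1 < n)
  have hlogn : 0 < Real.log n := Real.log_pos hn1
  simp only [Function.comp_apply, Real.norm_eq_abs, abs_of_pos hlogn,
    abs_of_pos (Real.rpow_pos_of_pos hn0 _)] at h1 h2 h3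
  set y := (n : ℝ) ^ (ε / 2) with hy
  set z := (n : ℝ) ^ (ε / 4) with hz
  have hyz : y = z * z := by
    rw [hy, hz, ← Real.rpow_add hn0]
    congr 1
    ring
  have hny : (n : ℝ) ^ ε = y * y := by
    rw [hy, ← Real.rpow_add hn0]
    congr 1
    ring
  have hd1 : z ≤ (⌊y⌋₊ : ℝ) := by
    have := Nat.lt_floor_add_one y
    nlinarith
  have hd2 : (⌊y⌋₊ : ℝ) ≤ y := Nat.floor_le (by positivity)
  refine ⟨?_, ?_, h2, ?_⟩
  · have : (1 : ℝ) ≤ (⌊y⌋₊ : ℝ) := by linarith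
    exact_mod_cast this
  · have : (n : ℝ) ≤ (⌊y⌋₊ : ℝ) ^ ⌈4 / ε⌉₊ := by
      calc (n : ℝ) = (n : ℝ) ^ (1 : ℝ) := (Real.rpow_one _).symm
        _ ≤ (n : ℝ) ^ (ε / 4 * (⌈4 / ε⌉₊ : ℝ)) := by
            refine Real.rpow_le_rpow_of_exponent_le hn1.le ?_
            calc (1 : ℝ) = ε / 4 * (4 / ε) := by field_simp
              _ ≤ _ := by gcongr; exact Nat.le_ceil _
        _ = z ^ ⌈4 / ε⌉₊ := by rw [Real.rpow_mul hn0.le, Real.rpow_natCast]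
        _ ≤ _ := by gcongr
    exact_mod_cast this
  · rw [le_div_iff₀ (by positivity), mul_assoc, ← pow_add, ← Real.exp_log hn0, ← Real.exp_nat_mul,
      ← Real.exp_add, Real.exp_log hn0, ← Real.exp_zero]
    refine Real.exp_le_exp.2 ?_
    rw [hny]
    push_cast
    have hy1 : 1 ≤ y := by nlinarith
    have h5 : ((⌊y⌋₊ : ℝ) + 2) * Real.log n ≤ (3 * y) * (1 / 36 * y) := by
      gcongr
      linarith
    nlinarith

/-! ### Expansion into a layer of the attribute graph -/

/-- Conditioning on the first coordinate: values in `A` are charged with probability 1, all others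
with `c`. -/
theorem compProd_real_le {X Y : Type*} [MeasurableSpace X] [MeasurableSpace Y] (m : Measure X)
    [IsProbabilityMeasure m] (κ : Kernel X Y) [IsMarkovKernel κ] {B : Set (X × Y)}
    (hB : MeasurableSet B) {A : Set X} (hA : MeasurableSet A) {c : ℝ} (hc : 0 ≤ c)
    (h : ∀ x, x ∉ A → (κ x).real (Prod.mk x ⁻¹' B) ≤ c) :
    (m.compProd κ).real B ≤ m.real A + c := by
  have h1 : (m.compProd κ) B ≤ m A + ENNReal.ofReal c := by
    rw [Measure.compProd_apply hB]
    calc _ ≤ ∫⁻ x, (A.indicator 1 x + ENNReal.ofReal c) ∂m := by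
          refine lintegral_mono fun x => ?_
          by_cases hx : x ∈ A
          · simpa [hx] using prob_le_one.trans (le_add_right le_rfl)
          · simp only [hx, not_false_eq_true, Set.indicator_of_notMem, zero_add]
            rw [← ofReal_measureReal]
            exact ENNReal.ofReal_le_ofReal (h x hx)
      _ = _ := by
          rw [lintegral_add_right _ measurable_const, lintegral_indicator_one hA]
          simp
  calc _ ≤ (m A + ENNReal.ofReal c).toReal := ENNReal.toReal_mono (by finiteness) h1
    _ = _ := by
        rw [ENNReal.toReal_add (by finiteness) (by finiteness), ENNReal.toReal_ofReal hc]
        rfl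

/-- The nodes with exactly `k` zeros. -/
def layer {n l : ℕ} (a : Attributes n l) (k : ℕ) : Finset (Fin n) :=
  Finset.univ.filter fun u => (Finset.univ.filter fun i : Fin l => a u i = 0).card = k

/-- A node of weight `k` is adjacent to every other node with probability at least
`β ^ k * γ ^ (l - k)`. -/
theorem le_edgeProb {n l k : ℕ} {α β γ : unitInterval} (hγβ : γ ≤ β) (hβα : β ≤ α)
    (a : Attributes n l) (u : Fin n) {t : Fin n} (ht : t ∈ layer a k) :
    (β : ℝ) ^ k * (γ : ℝ) ^ (l - k) ≤ edgeProb α β γ a s(u, t) := by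
  have hk := (Finset.mem_filter.1 ht).2
  have h1 : (β : ℝ) ^ k * (γ : ℝ) ^ (l - k) =
      ∏ i : Fin l, if a t i = 0 then (β : ℝ) else γ := by
    rw [Finset.prod_ite]
    simp only [Finset.prod_const, hk]
    congr 2
    rw [Finset.filter_not, Finset.card_sdiff_of_subset (Finset.filter_subset _ _), hk]
    simp
  have h2 : ((edgeProb α β γ a s(u, t) : unitInterval) : ℝ) =
      ∏ i : Fin l, (affinity α β γ (a u i) (a t i) : ℝ) := by
    change ((∏ i : Fin l, affinity α β γ (a u i) (a t i) : unitInterval) : ℝ) = _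
    exact map_prod unitInterval.submonoid.subtype _ _
  rw [h1, h2]
  -- The comparison is factorwise; the worst case is a node `u` whose attributes are all 1.
  refine Finset.prod_le_prod (fun i _ => ?_) fun i _ => ?_
  · split_ifs
    exacts [β.2.1, γ.2.1]
  · generalize a t i = y
    generalize a u i = x
    fin_cases x <;> fin_cases y <;> simp [affinity, hγβ, hβα]

/-- With high probability the nodes of weight `k` are numerous and make the graph expanding. -/
theorem model_not_expanding_le {n l k d : ℕ} (hn : 0 < n) {μ α β γ : unitInterval}
    (hγβ : γ ≤ β) (hβα : β ≤ α) {q : ℝ}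
    (hq : q = (l.choose k : ℝ) * (μ : ℝ) ^ k * (1 - (μ : ℝ)) ^ (l - k))
    (hd : Real.exp (-((β : ℝ) ^ k * (γ : ℝ) ^ (l - k) * (n * q) / 12)) * (n : ℝ) ^ d ≤
      1 / (n : ℝ) ^ 2) :
    (model n l μ α β γ).real {ω | ¬ (n * q / 4 ≤ (layer ω.1 k).card ∧
      Expanding (graph ω) (layer ω.1 k) d)} ≤
      Real.exp (-(n * q / 4)) + (Real.exp (1 / n) - 1) * Real.exp 1 := by
  have : Nonempty (Fin n) := ⟨⟨0, hn⟩⟩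
  have hp : 0 ≤ (β : ℝ) ^ k * (γ : ℝ) ^ (l - k) :=
    mul_nonneg (pow_nonneg β.2.1 _) (pow_nonneg γ.2.1 _)
  have hA := pi_card_filter_lt_le
    (Measure.pi fun _ : Fin l => bernoulliMeasure (0 : Fin 2) 1 μ) n
    {x | (Finset.univ.filter fun i => x i = 0).card = k}
  rw [pi_bernoulli_card_zeros, ← hq] at hA
  refine (compProd_real_le _ _ (Set.toFinite _).measurableSet
    (A := {a : Attributes n l | ((layer a k).card : ℝ) < n * q / 4})
    (Set.toFinite _).measurableSet (c := (Real.exp (1 / n) - 1) * Real.exp 1) ?_ ?_).trans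
    (add_le_add_left hA _)
  · have := Real.one_le_exp (by positivity : (0 : ℝ) ≤ 1 / n)
    have := Real.exp_pos 1
    nlinarith
  · intro a ha
    have hcard : n * q / 4 ≤ ((layer a k).card : ℝ) := not_lt.1 ha
    have := pi_bernoulli_not_expanding_le (edgeProb α β γ a) (layer a k) d hp
      (fun u t ht => le_edgeProb hγβ hβα a u ht) ?_
    · rw [Fintype.card_fin] at this
      refine le_trans (measureReal_mono ?_) this
      intro x hx hexp
      exact hx ⟨hcard, hexp⟩
    · rw [Fintype.card_fin]
      refine le_trans ?_ hd
      gcongr Real.exp (-?_) * _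
      linarith [mul_le_mul_of_nonneg_left hcard hp]

/-- Only the exceptional sets `B n` need be measurable; monotonicity handles `s n`. -/
theorem tendsto_real_of_compl_le {Ω : ℕ → Type*} [∀ n, MeasurableSpace (Ω n)]
    {m : ∀ n, Measure (Ω n)} [∀ n, IsProbabilityMeasure (m n)] {s B : ∀ n, Set (Ω n)}
    (hB : ∀ n, MeasurableSet (B n)) {c : ℕ → ℝ} (hc : Tendsto c atTop (𝓝 0))
    (h : ∀ᶠ n in atTop, (m n).real (B n) ≤ c n ∧ (B n)ᶜ ⊆ s n) :
    Tendsto (fun n => (m n).real (s n)) atTop (𝓝 1) := by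
  have h0 : Tendsto (fun n => 1 - c n) atTop (𝓝 1) := by simpa using hc.const_sub 1
  refine tendsto_of_tendsto_of_tendsto_of_le_of_le' h0 tendsto_const_nhds ?_
    (Eventually.of_forall fun n => measureReal_le_one)
  filter_upwards [h] with n hn
  have h1 := measureReal_mono (μ := m n) hn.2
  rw [probReal_compl_eq_one_sub (hB n)] at h1
  linarith [hn.1]

end MAG

/-! ### The diameter theorem -/

theorem theorem5p1 (μ α β γ : unitInterval) (ρ : ℝ)
    (hμ₀ : 0 < μ) (hμ₁ : μ < 1)
    (hγ : 0 < γ) (hγβ : γ < β) (hβα : β < α) (hα : α < 1) (hρ : 0 < ρ)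
    (hcond : 1 / 2 < ((μ : ℝ) * (β : ℝ) + (1 - (μ : ℝ)) * (γ : ℝ)) ^ ρ) :
    ∃ D : ℕ, ∀ l : ℕ → ℕ,
      Tendsto (fun n : ℕ => (l n : ℝ) / Real.logb 2 (n : ℝ)) atTop (𝓝 ρ) →
      Tendsto (fun n : ℕ => (MAG.model n (l n) μ α β γ).real
        {ω | (MAG.graph ω).ediam ≤ (D : ℕ∞)}) atTop (𝓝 1) ∧
      Tendsto (fun n : ℕ => (MAG.model n (l n) μ α β γ).real
        {ω | ((MAG.graph ω).induce (MAG.core ω (MAG.coreRatio μ β γ * (l n : ℝ)))).ediam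
          ≤ (D : ℕ∞)}) atTop (𝓝 1) ∧
      Tendsto (fun n : ℕ => (MAG.model n (l n) μ α β γ).real
        {ω | ∀ u, u ∉ MAG.core ω (MAG.coreRatio μ β γ * (l n : ℝ)) →
          ∃ v ∈ MAG.core ω (MAG.coreRatio μ β γ * (l n : ℝ)), (MAG.graph ω).Adj u v})
        atTop (𝓝 1) := by
  have hμ0 : (0 : ℝ) < μ := hμ₀
  have hμ1 : 0 < 1 - (μ : ℝ) := sub_pos.2 hμ₁
  have hγ0 : (0 : ℝ) < γ := hγ
  have hβ0 : (0 : ℝ) < β := hγ.trans hγβ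
  set x : ℝ := (μ : ℝ) * β + (1 - (μ : ℝ)) * γ with hx
  have hx0 : 0 < x := by positivity
  set r : ℝ := MAG.coreRatio μ β γ with hr
  have hrx : r * x = μ * β := by rw [hr, MAG.coreRatio, ← hx]; field_simp
  have hrx' : (1 - r) * x = (1 - (μ : ℝ)) * γ := by rw [sub_mul, hrx, hx]; ring
  have hr0 : 0 < r := by
    rw [hr, MAG.coreRatio]
    positivity
  have hr1 : 0 < 1 - r := by
    refine pos_of_mul_pos_left (b := x) ?_ hx0.le
    rw [hrx']
    positivity
  obtain ⟨ε, hε, hl⟩ := MAG.eventually_rpow_le hx0 hρ hcond (mul_pos hr0 hr1)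
  obtain ⟨K, d, hd⟩ := MAG.exists_growth hε
  refine ⟨2 * K + 2, fun l hlim => ?_⟩
  have hgood : ∀ᶠ n in atTop, ∃ k : ℕ, ∃ q : ℝ, r * l n ≤ k ∧ 8 ≤ n * q ∧
      (MAG.model n (l n) μ α β γ).real {ω | ¬ (n * q / 4 ≤ (MAG.layer ω.1 k).card ∧
        MAG.Expanding (MAG.graph ω) (MAG.layer ω.1 k) (d n))} ≤
        Real.exp (-((n : ℝ) ^ ε / 4)) + (Real.exp (1 / n) - 1) * Real.exp 1 := by
    filter_upwards [hl l hlim, hd, eventually_gt_atTop 0] with n ⟨hl0, hn1⟩ ⟨_, _, hn8, hdn⟩ hn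
    obtain ⟨k, hkl, hk, hmass⟩ :=
      MAG.exists_mean_le_binomial_mass hr0 (sub_pos.1 hr1) hl0
    set q : ℝ := ((l n).choose k : ℝ) * (μ : ℝ) ^ k * (1 - (μ : ℝ)) ^ (l n - k) with hq
    set p : ℝ := (β : ℝ) ^ k * (γ : ℝ) ^ (l n - k) with hp
    have hq0 : 0 ≤ q := by positivity
    have hp1 : p ≤ 1 :=
      mul_le_one₀ (pow_le_one₀ β.2.1 β.2.2) (pow_nonneg γ.2.1 _) (pow_le_one₀ γ.2.1 γ.2.2)
    -- Exponential tilting: μβ = r x and (1-μ)γ = (1-r) x turn p q into x^l times the binomial mass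
    -- with parameter r = λ.
    have hpq : p * q = x ^ l n * (((l n).choose k : ℝ) * r ^ k * (1 - r) ^ (l n - k)) := by
      have : x ^ l n = x ^ k * x ^ (l n - k) := by rw [← pow_add, Nat.add_sub_cancel' hkl]
      calc p * q = ((l n).choose k : ℝ) * (μ * β) ^ k * ((1 - μ) * γ) ^ (l n - k) := by
            rw [hp, hq, mul_pow, mul_pow]; ring
        _ = _ := by rw [← hrx, ← hrx', mul_pow, mul_pow, this]; ring
    have hM : (n : ℝ) ^ ε ≤ p * (n * q) := by
      refine hn1.trans ?_
      rw [mul_left_comm, hpq, mul_assoc]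
      gcongr
    have hnq : (n : ℝ) ^ ε ≤ n * q :=
      hM.trans (mul_le_of_le_one_left (by positivity) hp1)
    refine ⟨k, q, hk, hn8.trans hnq, ?_⟩
    refine (MAG.model_not_expanding_le hn hγβ.le hβα.le hq ?_).trans ?_
    · refine le_trans ?_ hdn
      gcongr
    · gcongr
  choose! k q hkq using hgood.exists_forall_of_atTop.choose_spec
  have hc : Tendsto (fun n : ℕ => Real.exp (-((n : ℝ) ^ ε / 4)) +
      (Real.exp (1 / n) - 1) * Real.exp 1) atTop (𝓝 0) := by
    have h1 : Tendsto (fun n : ℕ => Real.exp (-((n : ℝ) ^ ε / 4))) atTop (𝓝 0) :=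
      Real.tendsto_exp_neg_atTop_nhds_zero.comp
        (((tendsto_rpow_atTop hε).comp tendsto_natCast_atTop_atTop).atTop_div_const (by norm_num))
    have h2 : Tendsto (fun n : ℕ => Real.exp (1 / (n : ℝ))) atTop (𝓝 1) := by
      have := (Real.continuous_exp.tendsto 0).comp tendsto_one_div_atTop_nhds_zero_nat
      rwa [Real.exp_zero] at this
    simpa using h1.add ((h2.sub_const 1).mul_const (Real.exp 1))
  -- Each claim is reduced to a deterministic consequence of expansion into a layer inside the core.
  -- The bound n q ≥ 8 ensures that the layer has at least two nodes.
  have main : ∀ s : ∀ n, Set (MAG.Outcome n (l n)),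
      (∀ n, ∀ ω : MAG.Outcome n (l n), ∀ T : Finset (Fin n), 1 ≤ d n → 2 ≤ T.card →
        T.card ≤ d n ^ K → (T : Set (Fin n)) ⊆ MAG.core ω (r * l n) →
        MAG.Expanding (MAG.graph ω) T (d n) → ω ∈ s n) →
      Tendsto (fun n => (MAG.model n (l n) μ α β γ).real (s n)) atTop (𝓝 1) := by
    intro s hs
    refine MAG.tendsto_real_of_compl_le (fun n => (Set.toFinite {ω : MAG.Outcome n (l n) |
      ¬ (n * q n / 4 ≤ (MAG.layer ω.1 (k n)).card ∧
        MAG.Expanding (MAG.graph ω) (MAG.layer ω.1 (k n)) (d n))}).measurableSet) hc ?_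
    filter_upwards [hd, eventually_ge_atTop _] with n ⟨hd1, hdK, _, _⟩ hn
    obtain ⟨hk, hq, hle⟩ := hkq n hn
    refine ⟨hle, fun ω hω => ?_⟩
    obtain ⟨hcard, hexp⟩ := not_not.1 hω
    refine hs n ω _ hd1 ?_ ?_ ?_ hexp
    · have : (2 : ℝ) ≤ (MAG.layer ω.1 (k n)).card := by linarith
      exact_mod_cast this
    · exact (Finset.card_le_univ _).trans (by simpa using hdK)
    · intro t ht
      have : MAG.weight ω t = k n := (Finset.mem_filter.1 ht).2
      change r * l n ≤ (MAG.weight ω t : ℝ)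
      rwa [this]
  refine ⟨main _ fun n ω T hd1 hT hTK _ hexp => hexp.ediam_le hd1 hT hTK,
    main _ fun n ω T hd1 hT hTK hTS hexp => hexp.ediam_induce_le hd1 hT hTS hTK,
    main _ fun n ω T hd1 hT _ hTS hexp u _ => ?_⟩
  obtain ⟨t, ht, hut⟩ := hexp.exists_adj hd1 hT u
  exact ⟨t, hTS ht, hut⟩
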